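/- Let $\mathbb{K}$ be a field, let $n\ge 1$, and let $S=\mathbb{K}[x_1,\dots,x_n]$ with its standard $\mathbb{Z}^n$-grading. For a monomial ideal $J\subseteq S$, let $G(J)$ denote its set of minimal monomial generators. For $j\ge 0$, let $J_{\langle j\rangle}$ be the ideal generated by all monomials of degree $j$ belonging to $J$. The ideal $J$ has a *linear resolution* if there is an integer $d$ such that the $\mathbb{Z}$-graded Betti numbers of $J$ (given by the minimal $\mathbb{Z}^n$-graded free resolution of $J$ over $S$) satisfy $\beta_{i,i+t}(J)=0$ for all $i$ and all $t\ne d$. The ideal $J$ is *componentwise linear* if $J_{\langle j\rangle}$ has a linear resolution for every $j$. For a monomial $u$, let $\mathrm{supp}(u)$ be the set of variables dividing $u$. **Theorem.** Let $I\subseteq S$ be a monomial ideal which contains no variable (that is, $x_i\notin I$ for all $i$). Assume that there exists an integer $s\ge 1$ such that $I^s$ is componentwise linear. Then for all monomials $u,v\in G(I)$ with $\gcd(u,v)=1$ there exists a monomial $w\in G(I)$ such that $w\ne u$, $w\ne v$ and $\mathrm{supp}(w)\subseteq \mathrm{supp}(u)\cup\mathrm{supp}(v)$. -/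

import Mathlib

open MvPolynomial

/-- `I` is a monomial ideal: it is generated by a set of monomials. -/
def IsMonomialIdeal {n : ℕ} {K : Type*} [Field K] (I : Ideal (MvPolynomial (Fin n) K)) : Prop :=
  ∃ A : Set (Fin n →₀ ℕ), I = Ideal.span ((fun a => monomial a (1 : K)) '' A)

/-- `G(I)`: the minimal monomial generators of a monomial ideal `I`, i.e. the monomials in `I`
that are minimal with respect to divisibility among all monomials in `I`. -/
noncomputable def minimalMonomialGenerators {n : ℕ} {K : Type*} [Field K]
    (I : Ideal (MvPolynomial (Fin n) K)) : Set (MvPolynomial (Fin n) K) :=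
  (fun a => monomial a (1 : K)) '' {a | Minimal (fun b : Fin n →₀ ℕ => monomial b (1 : K) ∈ I) a}

/-- `I_⟨j⟩`: the ideal generated by all monomials of degree `j` belonging to `I`. -/
noncomputable def degreeComponentIdeal {n : ℕ} {K : Type*} [Field K]
    (I : Ideal (MvPolynomial (Fin n) K)) (j : ℕ) : Ideal (MvPolynomial (Fin n) K) :=
  Ideal.span {f | ∃ a : Fin n →₀ ℕ, a.degree = j ∧ f = monomial a (1 : K) ∧ f ∈ I}

/-- The graded piece `S_c` of multidegree `c ∈ ℤⁿ` of `S = K[x₁, …, xₙ]`: the line spanned by `x^c`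
if `c ∈ ℕⁿ`, and zero otherwise. -/
def multigradedPiece {n : ℕ} (K : Type*) [Field K] (c : Fin n → ℤ) :
    Set (MvPolynomial (Fin n) K) :=
  {f | ∀ m ∈ f.support, ∀ l, (m l : ℤ) = c l}

/-- A minimal `ℤⁿ`-graded free resolution `0 → F_p → ⋯ → F_1 → F_0 → J → 0` of an ideal `J`.
Here `F_i = ⨁_k S(-deg i k)`, where `k` runs over the `rank i` elements of a homogeneous basis. -/
structure MinimalGradedFreeResolution {n : ℕ} {K : Type*} [Field K]
    (J : Ideal (MvPolynomial (Fin n) K)) where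
  /-- the number of elements of the homogeneous basis of `F_i` -/
  rank : ℕ → ℕ
  /-- the multidegrees of the basis elements of `F_i` -/
  deg : (i : ℕ) → Fin (rank i) → Fin n → ℤ
  /-- the augmentation `F_0 → J` -/
  aug : (Fin (rank 0) → MvPolynomial (Fin n) K) →ₗ[MvPolynomial (Fin n) K] J
  /-- the differentials `F_{i+1} → F_i` -/
  diff : (i : ℕ) → (Fin (rank (i + 1)) → MvPolynomial (Fin n) K) →ₗ[MvPolynomial (Fin n) K]
    (Fin (rank i) → MvPolynomial (Fin n) K)
  /-- the augmentation is homogeneous of degree `0` -/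
  aug_graded : ∀ k, (aug (Pi.single k 1) : MvPolynomial (Fin n) K) ∈ multigradedPiece K (deg 0 k)
  /-- the differentials are homogeneous of degree `0` -/
  diff_graded : ∀ i k l,
    diff i (Pi.single k 1) l ∈ multigradedPiece K (deg (i + 1) k - deg i l)
  /-- exactness at `J` -/
  aug_surjective : Function.Surjective aug
  /-- exactness at `F_0` -/
  exact_zero : Function.Exact (diff 0) aug
  /-- exactness at `F_{i+1}` -/
  exact_succ : ∀ i, Function.Exact (diff (i + 1)) (diff i)
  /-- the resolution has finite length -/
  finite_length : ∃ p, ∀ i, p < i → rank i = 0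
  /-- minimality: the image of each differential lies in `(x₁, …, xₙ) F_i` -/
  minimal : ∀ i f l, diff i f l ∈ Ideal.span (Set.range (X : Fin n → MvPolynomial (Fin n) K))

/-- The `i`th `ℤⁿ`-graded Betti number of multidegree `a`, read off a minimal resolution: the
number of copies of `S(-a)` in `F_i`. -/
noncomputable def MinimalGradedFreeResolution.multigradedBetti {n : ℕ} {K : Type*} [Field K]
    {J : Ideal (MvPolynomial (Fin n) K)} (F : MinimalGradedFreeResolution J)
    (i : ℕ) (a : Fin n → ℤ) : ℕ :=
  Nat.card {k : Fin (F.rank i) // F.deg i k = a}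

/-- The `i`th `ℤ`-graded Betti number of degree `j`: the sum of the `ℤⁿ`-graded Betti numbers
of all multidegrees `a` with `|a| = a₁ + ⋯ + aₙ = j` (a sum with only finitely many nonzero terms). -/
noncomputable def MinimalGradedFreeResolution.betti {n : ℕ} {K : Type*} [Field K]
    {J : Ideal (MvPolynomial (Fin n) K)} (F : MinimalGradedFreeResolution J)
    (i : ℕ) (j : ℤ) : ℕ :=
  ∑ᶠ a ∈ {a : Fin n → ℤ | ∑ l, a l = j}, F.multigradedBetti i a

/-- Sanity check for the finite sum: the `ℤ`-graded Betti number counts the basis elements of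
total degree `j`. -/
theorem MinimalGradedFreeResolution.betti_eq_card {n : ℕ} {K : Type*} [Field K]
    {J : Ideal (MvPolynomial (Fin n) K)} (F : MinimalGradedFreeResolution J) (i : ℕ) (j : ℤ) :
    F.betti i j = Nat.card {k : Fin (F.rank i) // ∑ l, F.deg i k l = j} := by
  classical
  unfold betti multigradedBetti
  rw [finsum_mem_eq_sum_of_inter_support_eq (t := (Finset.univ.image (F.deg i)).filter
    (fun a => ∑ l, a l = j))]
  · simp only [Nat.card_eq_fintype_card, Fintype.card_subtype]
    rw [Finset.card_eq_sum_card_fiberwise (f := F.deg i)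
      (t := (Finset.univ.image (F.deg i)).filter (fun a => ∑ l, a l = j))]
    · refine Finset.sum_congr rfl fun a ha => ?_
      congr 1
      ext k
      simp only [Finset.mem_filter, Finset.mem_univ, true_and] at ha ⊢
      constructor
      · rintro rfl
        exact ⟨ha.2, rfl⟩
      · exact fun h => h.2
    · intro k hk
      simp at hk ⊢
      exact hk
  · ext a
    simp only [Set.mem_inter_iff, Set.mem_ofPred_eq, Function.mem_support, Finset.coe_filter,
      Finset.mem_image, Finset.mem_univ, true_and]
    constructor
    · rintro ⟨h1, h2⟩
      obtain ⟨⟨k, hk⟩⟩ := (Nat.card_ne_zero.mp h2).1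
      exact ⟨⟨⟨k, hk⟩, h1⟩, h2⟩
    · rintro ⟨⟨_, h1⟩, h2⟩
      exact ⟨h1, h2⟩

/-- `J` has a linear resolution: for some integer `d`, `β_{i,i+t}(J) = 0` for all `i` and all
`t ≠ d`. As minimal graded free resolutions exist and the Betti numbers do not depend on the choice
of one, they are computed from some minimal resolution. -/
def HasLinearResolution {n : ℕ} {K : Type*} [Field K]
    (J : Ideal (MvPolynomial (Fin n) K)) : Prop :=
  ∃ F : MinimalGradedFreeResolution J, ∃ d : ℤ, ∀ (i : ℕ) (t : ℤ), t ≠ d → F.betti i (i + t) = 0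

/-- `I` is componentwise linear: `I_⟨j⟩` has a linear resolution for all `j`. -/
def IsComponentwiseLinear {n : ℕ} {K : Type*} [Field K]
    (I : Ideal (MvPolynomial (Fin n) K)) : Prop :=
  ∀ j : ℕ, HasLinearResolution (degreeComponentIdeal I j)

/-! Let deg u ≤ deg v and suppose u, v are the only generators supported in supp(u) ∪ supp(v).
Choose q dividing v with deg q = deg v − deg u. Then M = u^(s-1) v and N = u^s q are distinct
monomials of I^s of one degree j. Linearity of the degree j component yields a monomial P ≠ M of
degree j in I^s that divides lcm(M, N) and satisfies deg lcm(M, P) ≤ j + 1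
(`exists_linear_neighbor`). As P divides u^s v, it is divisible by some u^i v^k with i + k = s
(`exists_nsmul_add_le_of_monomial_mem_pow`), and k ≤ 1 by coprimality. If k = 1, then M divides P,
so P = M. If k = 0, then u^s v divides lcm(M, P), whose degree is then at least j + deg u ≥ j + 2,
because I contains no variable. Both are impossible. -/

/-! ### Monomials in monomial ideals and their powers. -/

section MonomialIdeals

open scoped Pointwise

variable {n : ℕ} {K : Type*} [Field K]

/-- An ideal containing a nonzero element concentrated in multidegree `P` contains `x^P`. -/
theorem monomial_mem_of_mem_multigradedPiece {J : Ideal (MvPolynomial (Fin n) K)}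
    {f : MvPolynomial (Fin n) K} {c : Fin n → ℤ} (hf : f ∈ J) (hc : f ∈ multigradedPiece K c)
    {P : Fin n →₀ ℕ} (hP : coeff P f ≠ 0) : monomial P (1 : K) ∈ J := by
  have key : monomial P (1 : K) = C (coeff P f)⁻¹ * f := by
    ext m
    rw [coeff_C_mul, coeff_monomial]
    split_ifs with h
    · subst h
      rw [inv_mul_cancel₀ hP]
    · have : coeff m f = 0 := by
        by_contra hm
        apply h
        ext l
        have h1 := hc m (mem_support_iff.2 hm) l
        have h2 := hc P (mem_support_iff.2 hP) l
        omega
      rw [this, mul_zero]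
  rw [key]
  exact J.mul_mem_left _ hf

theorem exists_coeff_ne_zero_of_coeff_mul_ne_zero {f g : MvPolynomial (Fin n) K}
    {p : Fin n →₀ ℕ} (h : coeff p (f * g) ≠ 0) :
    ∃ a b, a + b = p ∧ coeff a f ≠ 0 ∧ coeff b g ≠ 0 := by
  rw [coeff_mul] at h
  obtain ⟨⟨a, b⟩, hab, hne⟩ := Finset.exists_ne_zero_of_sum_ne_zero h
  exact ⟨a, b, Finset.HasAntidiagonal.mem_antidiagonal.1 hab, left_ne_zero_of_mul hne, right_ne_zero_of_mul hne⟩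

theorem degree_le_of_monomial_mem_degreeComponentIdeal {I : Ideal (MvPolynomial (Fin n) K)}
    {j : ℕ} {P : Fin n →₀ ℕ} (h : monomial P (1 : K) ∈ degreeComponentIdeal I j) :
    j ≤ P.degree := by
  have hset : {f | ∃ a : Fin n →₀ ℕ, a.degree = j ∧ f = monomial a (1 : K) ∧ f ∈ I} =
      (fun a => monomial a (1 : K)) '' {a | a.degree = j ∧ monomial a (1 : K) ∈ I} := by
    ext f
    constructor
    · rintro ⟨a, ha, rfl, hf⟩
      exact ⟨a, ⟨ha, hf⟩, rfl⟩
    · rintro ⟨a, ⟨ha, hf⟩, rfl⟩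
      exact ⟨a, ha, rfl, hf⟩
  rw [degreeComponentIdeal, hset, mem_ideal_span_monomial_image] at h
  obtain ⟨a, ⟨ha, -⟩, hle⟩ := h P (by simp [mem_support_iff])
  exact ha ▸ Finsupp.degree_mono hle

theorem degreeComponentIdeal_le (I : Ideal (MvPolynomial (Fin n) K)) (j : ℕ) :
    degreeComponentIdeal I j ≤ I := by
  rw [degreeComponentIdeal, Ideal.span_le]
  rintro f ⟨a, -, -, hf⟩
  exact hf

theorem exists_minimal_le_of_monomial_mem {I : Ideal (MvPolynomial (Fin n) K)}
    {a : Fin n →₀ ℕ} (ha : monomial a (1 : K) ∈ I) :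
    ∃ m ≤ a, Minimal (fun b : Fin n →₀ ℕ => monomial b (1 : K) ∈ I) m :=
  exists_minimal_le_of_wellFoundedLT (fun b : Fin n →₀ ℕ => monomial b (1 : K) ∈ I) a ha

theorem image_monomial_mul_image_monomial (A B : Set (Fin n →₀ ℕ)) :
    (fun a => monomial a (1 : K)) '' A * (fun a => monomial a (1 : K)) '' B =
      (fun a => monomial a (1 : K)) '' (A + B) :=
  (Set.image_image2_distrib fun a b => by simp [monomial_mul]).symm

theorem IsMonomialIdeal.pow {I : Ideal (MvPolynomial (Fin n) K)} (hI : IsMonomialIdeal I)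
    (s : ℕ) : IsMonomialIdeal (I ^ s) := by
  induction s with
  | zero => exact ⟨{0}, by simp [← C_apply]⟩
  | succ s ih =>
    obtain ⟨A, hA⟩ := ih
    obtain ⟨B, hB⟩ := hI
    exact ⟨A + B, by rw [pow_succ, hA, hB, Ideal.span_mul_span', image_monomial_mul_image_monomial]⟩

/-- A monomial in a product of monomial ideals is divisible by a product of monomials of the
factors. -/
theorem IsMonomialIdeal.exists_add_le_of_monomial_mem_mul {I J : Ideal (MvPolynomial (Fin n) K)}
    (hI : IsMonomialIdeal I) (hJ : IsMonomialIdeal J) {P : Fin n →₀ ℕ}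
    (hP : monomial P (1 : K) ∈ I * J) :
    ∃ a b, a + b ≤ P ∧ monomial a (1 : K) ∈ I ∧ monomial b (1 : K) ∈ J := by
  obtain ⟨A, rfl⟩ := hI
  obtain ⟨B, rfl⟩ := hJ
  rw [Ideal.span_mul_span', image_monomial_mul_image_monomial, mem_ideal_span_monomial_image] at hP
  obtain ⟨_, ⟨a, ha, b, hb, rfl⟩, hle⟩ := hP P (by simp [mem_support_iff])
  exact ⟨a, b, hle, Ideal.subset_span ⟨a, ha, rfl⟩, Ideal.subset_span ⟨b, hb, rfl⟩⟩

/-- If `u` and `v` are the only minimal generators of `I` supported in `T`, then a monomial of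
`I ^ s` supported in `T` lies in `(u, v) ^ s`. -/
theorem IsMonomialIdeal.exists_nsmul_add_le_of_monomial_mem_pow
    {I : Ideal (MvPolynomial (Fin n) K)} (hI : IsMonomialIdeal I) {u v : Fin n →₀ ℕ}
    {T : Finset (Fin n)}
    (huv : ∀ m, Minimal (fun b : Fin n →₀ ℕ => monomial b (1 : K) ∈ I) m →
      m.support ⊆ T → m = u ∨ m = v) (s : ℕ) (P : Fin n →₀ ℕ) (hT : P.support ⊆ T)
    (hP : monomial P (1 : K) ∈ I ^ s) :
    ∃ i k : ℕ, i + k = s ∧ i • u + k • v ≤ P := by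
  induction s generalizing P with
  | zero => exact ⟨0, 0, rfl, by simp⟩
  | succ s ih =>
    rw [pow_succ] at hP
    obtain ⟨a, b, hab, ha, hb⟩ := (hI.pow s).exists_add_le_of_monomial_mem_mul hI hP
    obtain ⟨m, hmb, hm⟩ := exists_minimal_le_of_monomial_mem hb
    have haP : a ≤ P := le_trans (le_add_of_nonneg_right zero_le) hab
    have hmP : m ≤ P := hmb.trans (le_trans (le_add_of_nonneg_left zero_le) hab)
    obtain ⟨i, k, hik, hle⟩ := ih a ((Finsupp.support_mono haP).trans hT) ha
    rcases huv m hm ((Finsupp.support_mono hmP).trans hT) with rfl | rfl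
    · refine ⟨i + 1, k, by omega, le_trans ?_ ((add_le_add hle hmb).trans hab)⟩
      rw [add_smul, one_smul, add_right_comm]
    · refine ⟨i, k + 1, by omega, le_trans ?_ ((add_le_add hle hmb).trans hab)⟩
      rw [add_smul, one_smul, add_assoc]

end MonomialIdeals

/-! ### Linear relations read off the first syzygies. -/

section LinearResolutions

variable {n : ℕ} {K : Type*} [Field K] {J : Ideal (MvPolynomial (Fin n) K)}

theorem MinimalGradedFreeResolution.sum_deg_ne_of_betti_eq_zero
    (F : MinimalGradedFreeResolution J) {i : ℕ} {t : ℤ} (h : F.betti i t = 0)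
    (k : Fin (F.rank i)) : ∑ l, F.deg i k l ≠ t := by
  rw [F.betti_eq_card, Nat.card_eq_zero] at h
  rcases h with h | h
  · exact fun hk => h.elim ⟨k, hk⟩
  · exact (not_finite_iff_infinite.2 h inferInstance).elim

theorem MinimalGradedFreeResolution.aug_apply (F : MinimalGradedFreeResolution J)
    (z : Fin (F.rank 0) → MvPolynomial (Fin n) K) :
    (F.aug z : MvPolynomial (Fin n) K) = ∑ l, z l * (F.aug (Pi.single l 1)) := by
  classical
  rw [LinearMap.pi_apply_eq_sum_univ F.aug z, AddSubmonoidClass.coe_finsetSum]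
  refine Finset.sum_congr rfl fun l _ => ?_
  rw [Submodule.coe_smul, smul_eq_mul]
  congr 4
  funext x
  simp [Pi.single_apply, eq_comm]

theorem MinimalGradedFreeResolution.diff_apply (F : MinimalGradedFreeResolution J) (i : ℕ)
    (f : Fin (F.rank (i + 1)) → MvPolynomial (Fin n) K) (l : Fin (F.rank i)) :
    F.diff i f l = ∑ k, f k * F.diff i (Pi.single k 1) l := by
  classical
  rw [LinearMap.pi_apply_eq_sum_univ (F.diff i) f, Finset.sum_apply]
  refine Finset.sum_congr rfl fun k _ => ?_
  rw [Pi.smul_apply, smul_eq_mul]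
  congr 2
  refine congrFun (congrArg (F.diff i) ?_) l
  funext x
  simp [Pi.single_apply, eq_comm]

theorem MinimalGradedFreeResolution.coe_eq_deg_zero (F : MinimalGradedFreeResolution J)
    {l : Fin (F.rank 0)} {P : Fin n →₀ ℕ}
    (h : coeff P (F.aug (Pi.single l 1) : MvPolynomial (Fin n) K) ≠ 0) :
    (fun x => (P x : ℤ)) = F.deg 0 l :=
  funext (F.aug_graded l P (mem_support_iff.2 h))

/-- A monomial of `J` is divisible by a monomial of `J` which is the degree of a basis element
of `F_0`. -/
theorem MinimalGradedFreeResolution.exists_deg_zero_le (F : MinimalGradedFreeResolution J)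
    {M : Fin n →₀ ℕ} (hM : monomial M (1 : K) ∈ J) :
    ∃ P ≤ M, monomial P (1 : K) ∈ J ∧ ∃ l, (fun x => (P x : ℤ)) = F.deg 0 l := by
  obtain ⟨z, hz⟩ := F.aug_surjective ⟨_, hM⟩
  have h1 : coeff M (F.aug z : MvPolynomial (Fin n) K) ≠ 0 := by simp [hz]
  rw [F.aug_apply, coeff_sum] at h1
  obtain ⟨l, -, hl⟩ := Finset.exists_ne_zero_of_sum_ne_zero h1
  obtain ⟨a, P, hab, -, hb⟩ := exists_coeff_ne_zero_of_coeff_mul_ne_zero hl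
  exact ⟨P, hab ▸ le_add_of_nonneg_left zero_le,
    monomial_mem_of_mem_multigradedPiece (F.aug _).2 (F.aug_graded l) hb, l, F.coe_eq_deg_zero hb⟩

theorem degree_eq_of_coe_eq {P : Fin n →₀ ℕ} {c : Fin n → ℤ} {d : ℕ}
    (h : (fun x => (P x : ℤ)) = c) (hc : ∑ l, c l = d) : P.degree = d := by
  rw [Finsupp.degree_eq_sum]
  subst h
  simp only at hc
  exact_mod_cast hc

/-- If `F_0` is generated in degree `d` and `F_1` in degree `d + 1`, then any degree `d` monomial
`M` of `J` is linearly related, below its least common multiple with a given other degree `d`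
monomial of `J`, to some degree `d` monomial `P ≠ M` of `J`. -/
theorem MinimalGradedFreeResolution.exists_linear_neighbor (F : MinimalGradedFreeResolution J)
    {d : ℕ} (h0 : ∀ k, ∑ l, F.deg 0 k l = d) (h1 : ∀ k, ∑ l, F.deg 1 k l = d + 1)
    {M N : Fin n →₀ ℕ} (hM : monomial M (1 : K) ∈ J) (hN : monomial N (1 : K) ∈ J)
    (hMd : M.degree = d) (hNd : N.degree = d) (hMN : M ≠ N) :
    ∃ P, monomial P (1 : K) ∈ J ∧ P.degree = d ∧ P ≠ M ∧ P ≤ M ⊔ N ∧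
      (M ⊔ P).degree ≤ d + 1 := by
  classical
  set A : Fin (F.rank 0) → MvPolynomial (Fin n) K := fun l => F.aug (Pi.single l 1) with hA
  set D : Fin (F.rank 1) → Fin (F.rank 0) → MvPolynomial (Fin n) K :=
    fun k => F.diff 0 (Pi.single k 1) with hD
  -- Basis elements of multidegree M; restricting a syzygy to these coordinates isolates its M-part.
  set T : Finset (Fin (F.rank 0)) :=
    Finset.univ.filter fun l => F.deg 0 l = fun x => (M x : ℤ) with hT
  have coe_inj : ∀ a b : Fin n →₀ ℕ, (fun x => (a x : ℤ)) = (fun x => (b x : ℤ)) → a = b := by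
    intro a b h
    ext x
    exact_mod_cast congrFun h x
  have eq_of_le : ∀ a b : Fin n →₀ ℕ, a ≤ b → a.degree = b.degree → a = b := by
    intro a b hab hdeg
    obtain ⟨c, rfl⟩ := exists_add_of_le hab
    rw [map_add] at hdeg
    rw [(Finsupp.degree_eq_zero_iff c).1 (by omega), add_zero]
  have DA : ∀ k l p, coeff p (D k l * A l) ≠ 0 → (fun x => (p x : ℤ)) = F.deg 1 k ∧
      ∃ P ≤ p, (fun x => (P x : ℤ)) = F.deg 0 l ∧ monomial P (1 : K) ∈ J := by
    intro k l p hp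
    obtain ⟨a, b, rfl, ha, hb⟩ := exists_coeff_ne_zero_of_coeff_mul_ne_zero hp
    have hb' := F.coe_eq_deg_zero hb
    refine ⟨?_, b, le_add_of_nonneg_left zero_le, hb',
      monomial_mem_of_mem_multigradedPiece (F.aug _).2 (F.aug_graded l) hb⟩
    ext x
    have h2 := F.diff_graded 0 k l a (mem_support_iff.2 ha) x
    have h3 := congrFun hb' x
    simp only [Pi.sub_apply] at h2 h3
    push_cast [Finsupp.add_apply]
    linarith
  by_contra hcon
  push Not at hcon
  -- Without such a P, the M-part of every syzygy has zero coefficient at lcm(M, N); below, the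
  -- syzygy between M and N gives coefficient 1.
  have kill : ∀ f, coeff (M ⊔ N) (∑ l ∈ T, F.diff 0 f l * A l) = 0 := by
    intro f
    have hsum : ∑ l ∈ T, F.diff 0 f l * A l = ∑ k, f k * ∑ l ∈ T, D k l * A l := by
      simp_rw [F.diff_apply 0 f, Finset.sum_mul, Finset.mul_sum]
      rw [Finset.sum_comm]
      simp only [mul_assoc]
      rfl
    rw [hsum, coeff_sum]
    refine Finset.sum_eq_zero fun k _ => ?_
    by_contra hne
    obtain ⟨q, p, hqp, -, hp⟩ := exists_coeff_ne_zero_of_coeff_mul_ne_zero hne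
    have hpc : p ≤ M ⊔ N := hqp ▸ le_add_of_nonneg_left zero_le
    -- The full sum vanishes, so a nonzero M-part in multidegree p must cancel against a basis
    -- element of another degree P. Then lcm(M, P) divides p, and p has degree d + 1.
    have hall : ∑ l, D k l * A l = 0 := by
      rw [hA, hD, ← F.aug_apply]
      exact congrArg Subtype.val ((F.exact_zero _).2 ⟨_, rfl⟩)
    have hp' : coeff p (∑ l ∈ Finset.univ.filter (fun l => ¬ F.deg 0 l = fun x => (M x : ℤ)),
        D k l * A l) ≠ 0 := by
      intro h
      apply hp
      rw [← Finset.sum_filter_add_sum_filter_not Finset.univ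
        (fun l => F.deg 0 l = fun x => (M x : ℤ))] at hall
      have := congrArg (coeff p) hall
      rwa [coeff_add, h, add_zero, coeff_zero] at this
    rw [coeff_sum] at hp hp'
    obtain ⟨l, hl, hlne⟩ := Finset.exists_ne_zero_of_sum_ne_zero hp
    obtain ⟨l', hl', hlne'⟩ := Finset.exists_ne_zero_of_sum_ne_zero hp'
    obtain ⟨hdeg, M', hM'p, hM', -⟩ := DA k l p hlne
    obtain ⟨-, P, hPp, hPdeg, hPJ⟩ := DA k l' p hlne'
    obtain rfl : M' = M := coe_inj _ _ (hM'.trans (Finset.mem_filter.1 hl).2)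
    refine absurd (hcon P hPJ (degree_eq_of_coe_eq hPdeg (h0 l')) ?_ (hPp.trans hpc)) ?_
    · rintro rfl
      exact (Finset.mem_filter.1 hl').2 hPdeg.symm
    · rw [not_lt]
      refine (Finsupp.degree_mono (sup_le hM'p hPp)).trans
        (degree_eq_of_coe_eq hdeg (d := d + 1) ?_).le
      exact_mod_cast h1 k
  obtain ⟨z₁, hz₁⟩ := F.aug_surjective ⟨_, hM⟩
  obtain ⟨z₂, hz₂⟩ := F.aug_surjective ⟨_, hN⟩
  obtain ⟨a, ha⟩ := exists_add_of_le (le_sup_left : M ≤ M ⊔ N)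
  obtain ⟨b, hb⟩ := exists_add_of_le (le_sup_right : N ≤ M ⊔ N)
  -- Lift to F_0 of the relation x^a x^M = x^b x^N = lcm(M, N).
  have hz : F.aug (monomial a (1 : K) • z₁ - monomial b (1 : K) • z₂) = 0 := by
    rw [map_sub, map_smul, map_smul, hz₁, hz₂]
    ext1
    simp only [Submodule.coe_sub, Submodule.coe_smul, smul_eq_mul, monomial_mul, mul_one,
      ZeroMemClass.coe_zero]
    rw [add_comm a, add_comm b, ← ha, ← hb, sub_self]
  obtain ⟨f, hf⟩ := (F.exact_zero _).1 hz
  have hk := kill f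
  have hsplit : ∑ l ∈ T, F.diff 0 f l * A l =
      monomial a (1 : K) * ∑ l ∈ T, z₁ l * A l - monomial b (1 : K) * ∑ l ∈ T, z₂ l * A l := by
    rw [hf, Finset.mul_sum, Finset.mul_sum, ← Finset.sum_sub_distrib]
    refine Finset.sum_congr rfl fun l _ => ?_
    simp only [Pi.sub_apply, Pi.smul_apply, smul_eq_mul]
    ring
  -- All generators have degree d, so a term of degree d can only come from a generator of exactly
  -- that multidegree.
  have hzA : ∀ (z : Fin (F.rank 0) → MvPolynomial (Fin n) K) l (Q : Fin n →₀ ℕ),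
      Q.degree = d → coeff Q (z l * A l) ≠ 0 → (fun x => (Q x : ℤ)) = F.deg 0 l := by
    intro z l Q hQ h
    obtain ⟨x, P, hxP, -, hP⟩ := exists_coeff_ne_zero_of_coeff_mul_ne_zero h
    have hP' := F.coe_eq_deg_zero hP
    obtain rfl : P = Q := eq_of_le P Q (hxP ▸ le_add_of_nonneg_left zero_le)
      ((degree_eq_of_coe_eq hP' (h0 l)).trans hQ.symm)
    exact hP'
  have e₁ : coeff M (∑ l ∈ T, z₁ l * A l) = 1 := by
    have : coeff M (F.aug z₁ : MvPolynomial (Fin n) K) = 1 := by simp [hz₁]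
    rw [F.aug_apply, coeff_sum] at this
    rw [coeff_sum, ← this]
    refine Finset.sum_subset (Finset.subset_univ _) fun l _ hl => ?_
    by_contra hne
    exact hl (Finset.mem_filter.2 ⟨Finset.mem_univ _, (hzA z₁ l M hMd hne).symm⟩)
  have e₂ : coeff N (∑ l ∈ T, z₂ l * A l) = 0 := by
    rw [coeff_sum]
    refine Finset.sum_eq_zero fun l hl => ?_
    by_contra hne
    exact hMN (coe_inj _ _ ((hzA z₂ l N hNd hne).trans (Finset.mem_filter.1 hl).2)).symm
  rw [hsplit, coeff_sub] at hk
  nth_rewrite 1 [ha] at hk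
  rw [hb, add_comm M, add_comm N, coeff_monomial_mul, coeff_monomial_mul, e₁, e₂] at hk
  simp at hk

/-- Vanishing Betti numbers put the basis of F_i in degree i + d; the presence of M forces d = j. -/
theorem HasLinearResolution.exists_linear_neighbor {I : Ideal (MvPolynomial (Fin n) K)} {j : ℕ}
    (hlin : HasLinearResolution (degreeComponentIdeal I j)) {M N : Fin n →₀ ℕ}
    (hM : monomial M (1 : K) ∈ I) (hN : monomial N (1 : K) ∈ I)
    (hMd : M.degree = j) (hNd : N.degree = j) (hMN : M ≠ N) :
    ∃ P, monomial P (1 : K) ∈ I ∧ P.degree = j ∧ P ≠ M ∧ P ≤ M ⊔ N ∧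
      (M ⊔ P).degree ≤ j + 1 := by
  obtain ⟨F, d, hF⟩ := hlin
  have hM' : monomial M (1 : K) ∈ degreeComponentIdeal I j :=
    Ideal.subset_span ⟨M, hMd, rfl, hM⟩
  have hN' : monomial N (1 : K) ∈ degreeComponentIdeal I j :=
    Ideal.subset_span ⟨N, hNd, rfl, hN⟩
  have hdeg : ∀ i k, ∑ l, F.deg i k l = i + d := by
    intro i k
    by_contra hne
    refine F.sum_deg_ne_of_betti_eq_zero (hF i (∑ l, F.deg i k l - i) fun h => hne ?_) k ?_
    · linarith
    · ring
  obtain ⟨Q, hQM, hQ, l, hl⟩ := F.exists_deg_zero_le hM'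
  have hQj : Q.degree = j := le_antisymm (hMd ▸ Finsupp.degree_mono hQM)
    (degree_le_of_monomial_mem_degreeComponentIdeal hQ)
  have hd : d = j := by
    have h := hdeg 0 l
    rw [← hl] at h
    rw [← hQj, Finsupp.degree_eq_sum]
    push_cast
    simpa using h.symm
  subst hd
  obtain ⟨P, hP, h⟩ := F.exists_linear_neighbor (fun k => by simpa using hdeg 0 k)
    (fun k => by rw [hdeg 1 k]; push_cast; ring) hM' hN' hMd hNd hMN
  exact ⟨P, degreeComponentIdeal_le I j hP, h⟩

end LinearResolutions

/-! ### The coprime pair u, v. -/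

section Main

variable {n : ℕ} {K : Type*} [Field K] {I : Ideal (MvPolynomial (Fin n) K)}

theorem two_le_degree_of_monomial_mem (hn : 1 ≤ n)
    (hvar : ∀ i : Fin n, (X i : MvPolynomial (Fin n) K) ∉ I) {u : Fin n →₀ ℕ}
    (hu : monomial u (1 : K) ∈ I) : 2 ≤ u.degree := by
  by_contra hlt
  -- A monomial of degree at most 1 divides a variable; degree 0 needs a variable to exist.
  have hle : ∃ i : Fin n, u ≤ Finsupp.single i 1 := by
    rcases Nat.lt_or_ge u.degree 1 with h | h
    · rw [(Finsupp.degree_eq_zero_iff u).1 (by omega)]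
      exact ⟨⟨0, hn⟩, zero_le⟩
    · have : u ∈ Set.range fun i : Fin n => Finsupp.single i 1 := by
        rw [Finsupp.range_single_one]
        exact (by omega : u.degree = 1)
      obtain ⟨i, rfl⟩ := this
      exact ⟨i, le_rfl⟩
  obtain ⟨i, hi⟩ := hle
  obtain ⟨c, hc⟩ := exists_add_of_le hi
  apply hvar i
  rw [X, hc, ← one_mul (1 : K), ← monomial_mul]
  exact I.mul_mem_right _ hu

theorem monomial_nsmul_mem_pow {u : Fin n →₀ ℕ} (hu : monomial u (1 : K) ∈ I) (s : ℕ) :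
    monomial (s • u) (1 : K) ∈ I ^ s := by
  rw [← one_pow (M := K) s, ← monomial_pow]
  exact Ideal.pow_mem_pow hu s

/-- The case `deg u ≤ deg v` of the theorem, in terms of exponent vectors. -/
theorem exists_minimal_support_subset_of_degree_le (hn : 1 ≤ n) (hI : IsMonomialIdeal I)
    (hvar : ∀ i : Fin n, (X i : MvPolynomial (Fin n) K) ∉ I) {s : ℕ} (hs : 1 ≤ s)
    (hlin : IsComponentwiseLinear (I ^ s)) {u v : Fin n →₀ ℕ}
    (hu : monomial u (1 : K) ∈ I) (hv : monomial v (1 : K) ∈ I)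
    (hdisj : ∀ l, u l = 0 ∨ v l = 0) (hdeg : u.degree ≤ v.degree) :
    ∃ w, Minimal (fun b : Fin n →₀ ℕ => monomial b (1 : K) ∈ I) w ∧ w ≠ u ∧ w ≠ v ∧
      w.support ⊆ u.support ∪ v.support := by
  by_contra hcon
  push Not at hcon
  -- From here on the power is s + 1.
  obtain ⟨s, rfl⟩ := Nat.exists_eq_add_of_le' hs
  have hu2 := two_le_degree_of_monomial_mem hn hvar hu
  have hv2 := two_le_degree_of_monomial_mem hn hvar hv
  obtain ⟨q, hqv, hq⟩ := Finsupp.exists_le_degree_eq v (v.degree - u.degree) (Nat.sub_le _ _)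
  have hM : monomial (s • u + v) (1 : K) ∈ I ^ (s + 1) := by
    rw [← one_mul (1 : K), ← monomial_mul, pow_succ]
    exact Ideal.mul_mem_mul (monomial_nsmul_mem_pow hu s) hv
  have hN : monomial ((s + 1) • u + q) (1 : K) ∈ I ^ (s + 1) := by
    rw [← one_mul (1 : K), ← monomial_mul]
    exact Ideal.mul_mem_right _ _ (monomial_nsmul_mem_pow hu (s + 1))
  have hMd : (s • u + v).degree = s * u.degree + v.degree := by simp
  have hNd : ((s + 1) • u + q).degree = s * u.degree + v.degree := by
    simp only [map_add, map_nsmul, smul_eq_mul, hq, add_mul, one_mul]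
    omega
  obtain ⟨l, hl⟩ : ∃ l, u l ≠ 0 := by
    by_contra! h
    obtain rfl : u = 0 := Finsupp.ext h
    simp at hu2
  obtain ⟨r, hr⟩ : ∃ r, v r ≠ 0 := by
    by_contra! h
    obtain rfl : v = 0 := Finsupp.ext h
    simp at hv2
  have hMN : s • u + v ≠ (s + 1) • u + q := by
    intro h
    have h1 := DFunLike.congr_fun h l
    have h2 := (hdisj l).resolve_left hl
    simp only [Finsupp.add_apply, Finsupp.smul_apply, smul_eq_mul, add_mul, one_mul, h2] at h1
    omega
  obtain ⟨P, hP, hPd, hPM, hPle, hPdeg⟩ :=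
    (hlin (s * u.degree + v.degree)).exists_linear_neighbor hM hN hMd hNd hMN
  have hPc : P ≤ (s + 1) • u + v := by
    refine hPle.trans (sup_le ?_ (add_le_add le_rfl hqv))
    rw [add_smul, one_smul]
    exact add_le_add (le_add_of_nonneg_right zero_le) le_rfl
  have hPsupp : P.support ⊆ u.support ∪ v.support := by
    intro x hx
    have h1 := hPc x
    rw [Finsupp.mem_support_iff] at hx
    rw [Finset.mem_union, Finsupp.mem_support_iff, Finsupp.mem_support_iff]
    by_contra! h
    simp [h.1, h.2] at h1
    exact hx h1
  obtain ⟨i, k, hik, hle⟩ := hI.exists_nsmul_add_le_of_monomial_mem_pow (u := u) (v := v)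
    (T := u.support ∪ v.support) (fun m hm hmT => by
      by_contra! h
      exact hcon m hm h.1 h.2 hmT) (s + 1) P hPsupp hP
  -- At r, where u vanishes, the exponents give k · v r ≤ v r.
  have hk : k ≤ 1 := by
    have h1 := (hle.trans hPc) r
    have h2 := (hdisj r).resolve_right hr
    simp only [Finsupp.add_apply, Finsupp.smul_apply, smul_eq_mul, h2, mul_zero, zero_add] at h1
    by_contra hk
    nlinarith [Nat.pos_of_ne_zero hr]
  rcases Nat.le_one_iff_eq_zero_or_eq_one.1 hk with rfl | rfl
  -- k = 0: the lcm of M and P is too large, as deg u ≥ 2.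
  · obtain rfl : i = s + 1 := by omega
    have hsup : (s + 1) • u + v ≤ (s • u + v) ⊔ P := by
      intro x
      have h1 := hle x
      simp only [Finsupp.add_apply, Finsupp.smul_apply, smul_eq_mul, Finsupp.sup_apply,
        zero_mul, add_zero] at h1 ⊢
      rcases hdisj x with h | h
      · simp [h]
      · rw [h, add_zero]
        exact le_sup_of_le_right h1
    have h1 := Finsupp.degree_mono hsup
    have h2 : ((s + 1) • u + v).degree = s * u.degree + u.degree + v.degree := by
      simp [add_mul]
    omega
  -- k = 1: M divides P and has the same degree.
  · obtain rfl : i = s := by omega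
    rw [one_smul] at hle
    obtain ⟨c, rfl⟩ := exists_add_of_le hle
    rw [map_add, hMd] at hPd
    apply hPM
    rw [(Finsupp.degree_eq_zero_iff c).1 (by omega), add_zero]

end Main

theorem theorem2p1 {K : Type*} [Field K] (n : ℕ) (hn : 1 ≤ n)
    (I : Ideal (MvPolynomial (Fin n) K)) (hI : IsMonomialIdeal I)
    (hvar : ∀ i : Fin n, (X i : MvPolynomial (Fin n) K) ∉ I)
    (hpow : ∃ s : ℕ, 1 ≤ s ∧ IsComponentwiseLinear (I ^ s)) :
    ∀ u ∈ minimalMonomialGenerators I, ∀ v ∈ minimalMonomialGenerators I, IsRelPrime u v →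
      ∃ w ∈ minimalMonomialGenerators I, w ≠ u ∧ w ≠ v ∧ w.vars ⊆ u.vars ∪ v.vars := by
  obtain ⟨s, hs, hlin⟩ := hpow
  rintro _ ⟨u, hu, rfl⟩ _ ⟨v, hv, rfl⟩ huv
  have hdisj : ∀ l, u l = 0 ∨ v l = 0 := by
    intro l
    by_contra! h
    have hX : ∀ a : Fin n →₀ ℕ, a l ≠ 0 → (X l : MvPolynomial (Fin n) K) ∣ monomial a 1 := by
      intro a ha
      rw [X, monomial_dvd_monomial]
      exact ⟨Or.inr (by simpa [Nat.one_le_iff_ne_zero] using ha), one_dvd _⟩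
    exact X_prime.not_isUnit (huv (hX u h.1) (hX v h.2))
  change Minimal (fun b : Fin n →₀ ℕ => monomial b (1 : K) ∈ I) u at hu
  change Minimal (fun b : Fin n →₀ ℕ => monomial b (1 : K) ∈ I) v at hv
  obtain ⟨w, hw, hwu, hwv, hsupp⟩ : ∃ w,
      Minimal (fun b : Fin n →₀ ℕ => monomial b (1 : K) ∈ I) w ∧ w ≠ u ∧ w ≠ v ∧
      w.support ⊆ u.support ∪ v.support := by
    rcases le_total u.degree v.degree with h | h
    · exact exists_minimal_support_subset_of_degree_le hn hI hvar hs hlin hu.prop hv.prop hdisj h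
    · obtain ⟨w, hw, hwv, hwu, hsupp⟩ := exists_minimal_support_subset_of_degree_le hn hI hvar
        hs hlin hv.prop hu.prop (fun l => (hdisj l).symm) h
      exact ⟨w, hw, hwu, hwv, Finset.union_comm v.support u.support ▸ hsupp⟩
  have hinj := monomial_left_injective (σ := Fin n) (one_ne_zero (α := K))
  refine ⟨_, ⟨w, hw, rfl⟩, hinj.ne hwu, hinj.ne hwv, ?_⟩
  simpa only [vars_monomial (one_ne_zero (α := K))] using hsupp
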